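/- Let $\lambda\in\mathbb{C}$ with $|\lambda|<1$ and let $a>0$. Let $\mathbb{T}^2=\{(z_1,z_2)\in\mathbb{C}^2: |z_1|=|z_2|=1\}$ and let $T:\mathbb{T}^2\to\mathbb{T}^2$ be the map $$T(z_1,z_2)=\left(z_1\,\frac{z_1-\lambda}{1-\bar\lambda z_1}\,z_2,\ \frac{z_1-\lambda}{1-\bar\lambda z_1}\,z_2\right).$$ Write $\varphi=(1+\sqrt5)/2$, $\lambda_u=\varphi^{2}$, $\lambda_s=\varphi^{-2}$, and for $n=(n_1,n_2)\in\mathbb{Z}^2$ put $n_u=(\lambda_u-1)n_1+n_2$, $n_s=(\lambda_s-1)n_1+n_2$ and $z^n=z_1^{n_1}z_2^{n_2}$. Let $\mathcal{H}_a$ be the Hilbert space obtained by completing the space of Laurent polynomials $f(z)=\sum_n f_n z^n$ (finite sums, $f_n\in\mathbb{C}$) with respect to the inner product $$\langle f,g\rangle_a=\sum_{n\in\mathbb{Z}^2} f_n\,\overline{g_n}\,\exp(-2a|n_u|+2a|n_s|).$$ A continuous function $g:\mathbb{T}^2\to\mathbb{C}$ with Fourier coefficients $(g_n)_{n\in\mathbb{Z}^2}$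 is identified with the element $\sum_n g_n z^n$ of $\mathcal{H}_a$ whenever this series converges in $\mathcal{H}_a$. Then $f\circ T$ belongs to $\mathcal{H}_a$ for every Laurent polynomial $f$, and there is a unique bounded linear operator $\mathcal{C}:\mathcal{H}_a\to\mathcal{H}_a$ with $\mathcal{C}f=f\circ T$ for every Laurent polynomial $f$. The operator $\mathcal{C}$ is compact, indeed Hilbert–Schmidt. Its spectrum is $$\sigma(\mathcal{C})=\{(-\lambda)^n: n\ge 1\}\cup\{(-\bar\lambda)^n: n\ge 1\}\cup\{1,0\}.$$ Each non-zero $\mu\in\sigma(\mathcal{C})$ is an eigenvalue, and its algebraic multiplicity (the dimension of $\bigcup_{k\ge1}\ker(\mathcal{C}-\mu)^k$) is finite and equals the number of times that $\mu$ occurs in the list consisting of $1$ (once), $(-\lambda)^n$ for $n\ge1$, and $(-\bar\lambda)^n$ for $n\ge1$. -/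

import Mathlib

open scoped ComplexConjugate

noncomputable section

namespace BlaschkeCat

/-! ### The map on the torus -/

/-- The unit torus `{(z₁, z₂) : |z₁| = |z₂| = 1}`. -/
abbrev Torus : Type := Circle × Circle

theorem one_sub_conj_mul_ne_zero {lam : ℂ} (hlam : ‖lam‖ < 1) (z : Circle) :
    1 - conj lam * (z : ℂ) ≠ 0 := by
  intro h
  have h1 : ‖conj lam * (z : ℂ)‖ = 1 := by
    rw [← sub_eq_zero.mp h, norm_one]
  rw [norm_mul, RCLike.norm_conj, Circle.norm_coe, mul_one] at h1
  exact hlam.ne h1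

theorem norm_blaschke {lam : ℂ} (hlam : ‖lam‖ < 1) (z : Circle) :
    ‖((z : ℂ) - lam) / (1 - conj lam * (z : ℂ))‖ = 1 := by
  have hne := one_sub_conj_mul_ne_zero hlam z
  have h : ((z : ℂ) - lam) = z * conj (1 - conj lam * (z : ℂ)) := by
    have hz : (z : ℂ) * conj (z : ℂ) = 1 := by
      rw [Complex.mul_conj, Circle.normSq_coe, Complex.ofReal_one]
    simp only [map_sub, map_one, map_mul, Complex.conj_conj]
    linear_combination lam * hz
  rw [norm_div, h, norm_mul, Circle.norm_coe, one_mul, RCLike.norm_conj]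
  exact div_self (norm_ne_zero_iff.mpr hne)

/-- The Blaschke factor `z ↦ (z - λ) / (1 - λ̄ z)` as a self-map of the unit circle. -/
def blaschke (lam : ℂ) (hlam : ‖lam‖ < 1) (z : Circle) : Circle :=
  ⟨((z : ℂ) - lam) / (1 - conj lam * (z : ℂ)), mem_sphere_zero_iff_norm.mpr (norm_blaschke hlam z)⟩

/-- The deformed cat map `T (z₁, z₂) = (z₁ B(z₁) z₂, B(z₁) z₂)`, with `B` the Blaschke factor. -/
def catMap (lam : ℂ) (hlam : ‖lam‖ < 1) (z : Torus) : Torus :=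
  (z.1 * blaschke lam hlam z.1 * z.2, blaschke lam hlam z.1 * z.2)

/-! ### Laurent polynomials with the anisotropic inner product -/

/-- `n_u = (λ_u - 1) n₁ + n₂` with `λ_u = φ ^ 2` and `φ` the golden ratio. -/
def unstableCoord (n : ℤ × ℤ) : ℝ := (Real.goldenRatio ^ 2 - 1) * n.1 + n.2

/-- `n_s = (λ_s - 1) n₁ + n₂` with `λ_s = φ ^ (-2)` and `φ` the golden ratio. -/
def stableCoord (n : ℤ × ℤ) : ℝ := ((Real.goldenRatio ^ 2)⁻¹ - 1) * n.1 + n.2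

/-- The weight `exp (-2 a |n_u| + 2 a |n_s|)`. -/
def weight (a : ℝ) (n : ℤ × ℤ) : ℝ :=
  Real.exp (-2 * a * |unstableCoord n| + 2 * a * |stableCoord n|)

theorem weight_pos (a : ℝ) (n : ℤ × ℤ) : 0 < weight a n := Real.exp_pos _

/-- Laurent polynomials in two variables, given by their finitely many non-zero coefficients
`f_n`, `n ∈ ℤ²`. The parameter `a` only selects the inner product put on them below. -/
def LaurentPoly (_a : ℝ) : Type := (ℤ × ℤ) →₀ ℂ

namespace LaurentPoly

variable {a : ℝ}

instance : AddCommGroup (LaurentPoly a) := inferInstanceAs (AddCommGroup ((ℤ × ℤ) →₀ ℂ))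

instance : Module ℂ (LaurentPoly a) := inferInstanceAs (Module ℂ ((ℤ × ℤ) →₀ ℂ))

/-- The coefficients of a Laurent polynomial. -/
def coeff (f : LaurentPoly a) : (ℤ × ℤ) →₀ ℂ := f

/-- The monomial `z ^ n`. -/
def monomial (a : ℝ) (n : ℤ × ℤ) : LaurentPoly a := (Finsupp.single n 1 : (ℤ × ℤ) →₀ ℂ)

/-- The function `z ↦ ∑ f_n z₁ ^ n₁ z₂ ^ n₂` on the torus defined by a Laurent polynomial. -/
def eval (f : LaurentPoly a) (z : Torus) : ℂ :=
  ∑ n ∈ f.coeff.support, f.coeff n * ((z.1 : ℂ) ^ n.1 * (z.2 : ℂ) ^ n.2)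

/-- `⟨f, g⟩_a = ∑ f_n conj(g_n) exp (-2 a |n_u| + 2 a |n_s|)`, written with Mathlib's convention
that inner products are conjugate-linear in the first argument. -/
def innerA (f g : LaurentPoly a) : ℂ :=
  g.coeff.sum fun n c => conj (f.coeff n) * c * (weight a n : ℂ)

theorem innerA_eq (f g : LaurentPoly a) (s : Finset (ℤ × ℤ)) (hs : g.coeff.support ⊆ s) :
    innerA f g = ∑ n ∈ s, conj (f.coeff n) * g.coeff n * (weight a n : ℂ) :=
  Finsupp.sum_of_support_subset _ hs _ (by simp)

/-- The inner product axioms for `⟨·, ·⟩_a`. -/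
@[reducible] def core (a : ℝ) : InnerProductSpace.Core ℂ (LaurentPoly a) where
  inner := innerA
  conj_inner_symm f g := by
    classical
    rw [innerA_eq f g _ (Finset.subset_union_right (s₁ := f.coeff.support)),
      innerA_eq g f _ (Finset.subset_union_left (s₂ := g.coeff.support)), map_sum]
    refine Finset.sum_congr rfl fun n _ => ?_
    simp only [map_mul, Complex.conj_conj, Complex.conj_ofReal]
    ring
  re_inner_nonneg f := by
    rw [innerA_eq f f _ subset_rfl, map_sum]
    refine Finset.sum_nonneg fun n _ => ?_
    rw [← Complex.normSq_eq_conj_mul_self, ← Complex.ofReal_mul]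
    exact mul_nonneg (Complex.normSq_nonneg _) (weight_pos a n).le
  add_left f g h := by
    rw [innerA_eq _ h _ subset_rfl, innerA_eq _ h _ subset_rfl, innerA_eq _ h _ subset_rfl,
      ← Finset.sum_add_distrib]
    refine Finset.sum_congr rfl fun n _ => ?_
    have : (f + g).coeff n = f.coeff n + g.coeff n := rfl
    rw [this, map_add]
    ring
  smul_left f g r := by
    rw [innerA_eq _ g _ subset_rfl, innerA_eq _ g _ subset_rfl, Finset.mul_sum]
    refine Finset.sum_congr rfl fun n _ => ?_
    have : (r • f).coeff n = r * f.coeff n := rfl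
    rw [this, map_mul]
    ring
  definite f hf := by
    have h0 : ∑ n ∈ f.coeff.support, Complex.normSq (f.coeff n) * weight a n = 0 := by
      have hf' : innerA f f = 0 := hf
      rw [innerA_eq f f _ subset_rfl] at hf'
      simp only [← Complex.normSq_eq_conj_mul_self, ← Complex.ofReal_mul,
        ← Complex.ofReal_sum] at hf'
      exact_mod_cast hf'
    have hnn : ∀ n ∈ f.coeff.support, 0 ≤ Complex.normSq (f.coeff n) * weight a n :=
      fun n _ => mul_nonneg (Complex.normSq_nonneg _) (weight_pos a n).le
    refine Finsupp.ext (f := f.coeff) (g := 0) fun n => ?_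
    by_contra hn
    have h1 := (Finset.sum_eq_zero_iff_of_nonneg hnn).mp h0 n (Finsupp.mem_support_iff.mpr hn)
    rcases mul_eq_zero.mp h1 with h2 | h2
    · exact hn (Complex.normSq_eq_zero.mp h2)
    · exact (weight_pos a n).ne' h2

instance : NormedAddCommGroup (LaurentPoly a) := (core a).toNormedAddCommGroup

instance : InnerProductSpace ℂ (LaurentPoly a) := InnerProductSpace.ofCore (core a).toCore

end LaurentPoly

/-! ### The Hilbert space and the composition operator -/

/-- The Hilbert space `H_a`: the completion of the Laurent polynomials in the norm `‖·‖_a`. -/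
abbrev HSpace (a : ℝ) : Type := UniformSpace.Completion (LaurentPoly a)

/-- The Fourier coefficient `g_n = ∫ g(z) z ^ (-n) dμ(z)` of a function on the torus, with `μ` the
normalised Haar measure, in the angular coordinates `z_j = exp (i θ_j)`. -/
def torusFourierCoeff (g : Torus → ℂ) (n : ℤ × ℤ) : ℂ :=
  (1 / (2 * (Real.pi : ℂ)) ^ 2) * ∫ θ₁ in (0 : ℝ)..2 * Real.pi, ∫ θ₂ in (0 : ℝ)..2 * Real.pi,
    g (Circle.exp θ₁, Circle.exp θ₂) *
      Complex.exp (-Complex.I * ((n.1 : ℂ) * (θ₁ : ℂ) + (n.2 : ℂ) * (θ₂ : ℂ)))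

/-- A continuous function `g` on the torus is identified with `F ∈ H_a` when its Fourier series
`∑ g_n z ^ n` converges to `F` in the norm of `H_a`. -/
def Represents {a : ℝ} (F : HSpace a) (g : Torus → ℂ) : Prop :=
  Continuous g ∧ HasSum (fun n : ℤ × ℤ => torusFourierCoeff g n • (LaurentPoly.monomial a n : HSpace a)) F

/-- A bounded operator on `H_a` is the composition operator of `T` when it maps every Laurent
polynomial `f` to (the element of `H_a` identified with) the function `f ∘ T`. -/
def IsCompositionOperator {a : ℝ} (C : HSpace a →L[ℂ] HSpace a) (T : Torus → Torus) : Prop :=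
  ∀ f : LaurentPoly a, Represents (C (f : HSpace a)) (fun z => f.eval (T z))

/-- Hilbert–Schmidt operators: `∑ ‖A e_i‖ ^ 2 < ∞` for an orthonormal basis `(e_i)`. -/
def IsHilbertSchmidt {H : Type} [NormedAddCommGroup H] [InnerProductSpace ℂ H]
    (A : H →L[ℂ] H) : Prop :=
  ∃ (ι : Type) (b : HilbertBasis ι ℂ H), Summable fun i => ‖A (b i)‖ ^ 2

/-- The generalised eigenspace `⋃ₖ ker (A - μ)ᵏ`; its dimension is the algebraic multiplicity. -/
abbrev genEigenspace {H : Type} [NormedAddCommGroup H] [InnerProductSpace ℂ H]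
    (A : H →L[ℂ] H) (μ : ℂ) : Submodule ℂ H :=
  Module.End.maxGenEigenspace (A : Module.End ℂ H) μ

/-- The list `1`, `(-λ)ⁿ`, `(-λ̄)ⁿ` (`n ≥ 1`), indexed by the integers: index `0` gives `1`, index
`n > 0` gives `(-λ)ⁿ`, and index `-n < 0` gives `(-λ̄)ⁿ`. -/
def eigenvalueList (lam : ℂ) (k : ℤ) : ℂ :=
  if 0 ≤ k then (-lam) ^ k.natAbs else (-conj lam) ^ k.natAbs

end BlaschkeCat

end

noncomputable section

/-! In the normalised monomials the operator is an explicit infinite matrix. With `B` the Blaschke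
factor and `m = n₁ + n₂`, one has `z^n ∘ T = z₁^{n₁} B(z₁)^m z₂^m`, so `n` is sent only to indices
`p = (n₁ + k, m)`, with entry the `k`-th Fourier coefficient of `B^m` times the ratio of the
weights.

Size. The coefficient is at most `r^{-|k|} ρ^{|m|}` for any `r < 1`, with `ρ < 1` a bound for `|B|`
on `|z| = r`. The loss `r^{-|k|}` is beaten by the anisotropic weight, whose exponent drops by at
least `|k|` along a transition, and also by at least `|n₁| - 2|m|` (`growth_drop`). Hence all
entries are absolutely summable (`exists_norm_catMatrix_le`), which gives boundedness, compactness
and the Hilbert–Schmidt property at once.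

Spectrum. `B` is holomorphic on the closed disc and unimodular on the circle, so `k` has the sign of
`m`, and `k = 0` if `m = 0`. The indices therefore split into three blocks: `S`, where `n₁ ≠ 0` and
`n₂` is zero or has the sign of `n₁`; `R`, where `n₁` and `n₂` have opposite signs; and the line `n₁
= 0`. Transitions never leave `S` and never enter `R` from outside; within `S` they strictly raise
`|n₂|`, within `R` they strictly lower it. A compact strictly triangular block has no non-zero
spectrum, so only the middle line contributes. There the matrix is diagonal, with entries the
constant terms of `B^m`: powers of `B(0) = -λ` for `m ≥ 0` and of its conjugate for `m < 0`. Each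
such entry has an eigenvector corrected inside `S`, and these span the generalised eigenspace
(`IsBlockTriangular.finrank_genEigenspace`), so no Jordan block occurs for `μ ≠ 0`. -/

namespace BlaschkeCat

/-! ### Operators given by an absolutely summable matrix in a Hilbert basis. -/

section MatrixOperator

variable {ι : Type} {H : Type} [NormedAddCommGroup H] [InnerProductSpace ℂ H] [CompleteSpace H]

/-- The operator with matrix `M` in the Hilbert basis `b`, `b n ↦ ∑ p, M n p • b p`. -/
def matrixOp (b : HilbertBasis ι ℂ H) (M : ι → ι → ℂ) : H →L[ℂ] H :=
  ∑' p : ι × ι, M p.1 p.2 • InnerProductSpace.rankOne ℂ (b p.2) (b p.1)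

theorem summable_matrixOp (b : HilbertBasis ι ℂ H) {M : ι → ι → ℂ}
    (hM : Summable fun p : ι × ι => ‖M p.1 p.2‖) :
    Summable fun p : ι × ι => M p.1 p.2 • InnerProductSpace.rankOne ℂ (b p.2) (b p.1) := by
  refine Summable.of_norm (hM.congr fun p => ?_)
  rw [norm_smul, InnerProductSpace.norm_rankOne, b.orthonormal.1, b.orthonormal.1, mul_one, mul_one]

theorem hasSum_matrixOp_apply (b : HilbertBasis ι ℂ H) {M : ι → ι → ℂ}
    (hM : Summable fun p : ι × ι => ‖M p.1 p.2‖) (x : H) :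
    HasSum (fun p : ι × ι => (M p.1 p.2 * inner ℂ (b p.1) x) • b p.2) (matrixOp b M x) := by
  have h := (summable_matrixOp b hM).hasSum.mapL (ContinuousLinearMap.apply ℂ H x)
  simpa [smul_smul, matrixOp] using h

theorem hasSum_matrixOp_basis (b : HilbertBasis ι ℂ H) {M : ι → ι → ℂ}
    (hM : Summable fun p : ι × ι => ‖M p.1 p.2‖) (n : ι) :
    HasSum (fun p => M n p • b p) (matrixOp b M (b n)) := by
  classical
  have h := hasSum_matrixOp_apply b hM (b n)
  have hi : Function.Injective fun p : ι => (n, p) := fun p q h => (Prod.ext_iff.mp h).2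
  rw [← hi.hasSum_iff] at h
  · refine h.congr_fun ?_ |> fun h => h
    intro p
    simp [orthonormal_iff_ite.mp b.orthonormal]
  · rintro ⟨m, p⟩ hp
    have hmn : m ≠ n := fun h => hp ⟨p, by simp [h]⟩
    simp [orthonormal_iff_ite.mp b.orthonormal, hmn]

theorem hasSum_inner_matrixOp (b : HilbertBasis ι ℂ H) {M : ι → ι → ℂ}
    (hM : Summable fun p : ι × ι => ‖M p.1 p.2‖) (x : H) (p : ι) :
    HasSum (fun n => M n p * inner ℂ (b n) x) (inner ℂ (b p) (matrixOp b M x)) := by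
  classical
  have h := (hasSum_matrixOp_apply b hM x).mapL (innerSL ℂ (b p))
  have hi : Function.Injective fun n : ι => (n, p) := fun p q h => (Prod.ext_iff.mp h).1
  rw [← hi.hasSum_iff] at h
  · refine h.congr_fun ?_ |> fun h => h
    intro n
    simp [orthonormal_iff_ite.mp b.orthonormal]
  · rintro ⟨m, q⟩ hp
    have hqp : p ≠ q := fun h => hp ⟨m, by simp [h]⟩
    simp [orthonormal_iff_ite.mp b.orthonormal, hqp]

theorem inner_matrixOp_basis (b : HilbertBasis ι ℂ H) {M : ι → ι → ℂ}
    (hM : Summable fun p : ι × ι => ‖M p.1 p.2‖) (n p : ι) :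
    inner ℂ (b p) (matrixOp b M (b n)) = M n p := by
  classical
  refine (hasSum_inner_matrixOp b hM (b n) p).unique ?_
  convert! hasSum_ite_eq n (M n p) using 2 with m
  by_cases h : m = n
  · simp [h, b.orthonormal.1]
  · simp [h, orthonormal_iff_ite.mp b.orthonormal]

omit [CompleteSpace H] in
theorem ext_inner_basis (b : HilbertBasis ι ℂ H) {x y : H}
    (h : ∀ n, inner ℂ (b n) x = inner ℂ (b n) y) : x = y := by
  refine b.repr.injective (lp.ext (funext fun n => ?_))
  rw [b.repr_apply_apply, b.repr_apply_apply, h n]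

/-- The rank-one expansion converges in operator norm, and compact operators form a closed subspace.
-/
theorem isCompactOperator_matrixOp (b : HilbertBasis ι ℂ H) {M : ι → ι → ℂ}
    (hM : Summable fun p : ι × ι => ‖M p.1 p.2‖) : IsCompactOperator (matrixOp b M) := by
  have hmem : matrixOp b M ∈ (compactOperator (RingHom.id ℂ) H H).topologicalClosure := by
    refine mem_closure_of_tendsto (summable_matrixOp b hM).hasSum (Filter.Eventually.of_forall ?_)
    intro s
    refine Submodule.sum_mem _ fun p _ => Submodule.smul_mem _ _ ?_
    change IsCompactOperator (InnerProductSpace.rankOne ℂ (b p.2) (b p.1))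
    rw [InnerProductSpace.rankOne_def']
    exact (isCompactOperator_id.comp_clm (innerSL ℂ (b p.1))).clm_comp
      (ContinuousLinearMap.toSpanSingleton ℂ (b p.2))
  rw [compactOperator_topologicalClosure] at hmem
  exact hmem

theorem adjoint_matrixOp (b : HilbertBasis ι ℂ H) {M : ι → ι → ℂ}
    (hM : Summable fun p : ι × ι => ‖M p.1 p.2‖) :
    ContinuousLinearMap.adjoint (matrixOp b M) = matrixOp b fun n p => conj (M p n) := by
  have h1 : Summable fun p : ι × ι => ‖conj (M p.2 p.1)‖ := by
    simpa using! ((Equiv.prodComm ι ι).summable_iff (f := fun p : ι × ι => ‖M p.1 p.2‖)).mpr hM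
  have key : ∀ n, ContinuousLinearMap.adjoint (matrixOp b M) (b n) =
      matrixOp b (fun n p => conj (M p n)) (b n) := by
    intro n
    refine ext_inner_basis b fun p => ?_
    have h2 := inner_matrixOp_basis (M := fun n p => conj (M p n)) b h1 n p
    rw [h2, ContinuousLinearMap.adjoint_inner_right, ← inner_conj_symm,
      inner_matrixOp_basis b hM p n]
  refine ContinuousLinearMap.ext_on (s := Set.range b) ?_ ?_
  · exact Submodule.dense_iff_topologicalClosure_eq_top.mpr b.dense_span
  · rintro _ ⟨n, rfl⟩
    exact key n

theorem isHilbertSchmidt_matrixOp (b : HilbertBasis ι ℂ H) {M : ι → ι → ℂ}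
    (hM : Summable fun p : ι × ι => ‖M p.1 p.2‖) : IsHilbertSchmidt (matrixOp b M) := by
  refine ⟨ι, b, ?_⟩
  have h1 : Summable fun n => ∑' p, ‖M n p‖ := hM.prod
  have h2 : ∀ n, ‖matrixOp b M (b n)‖ ≤ ∑' p, ‖M n p‖ := by
    intro n
    rw [← (hasSum_matrixOp_basis b hM n).tsum_eq]
    have h3 : ∀ p, ‖M n p • b p‖ = ‖M n p‖ := fun p => by
      rw [norm_smul, b.orthonormal.1, mul_one]
    simp only [← h3]
    exact norm_tsum_le_tsum_norm (by simpa only [h3] using hM.prod_factor n)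
  have h4 : Summable fun n => ‖matrixOp b M (b n)‖ :=
    Summable.of_nonneg_of_le (fun _ => norm_nonneg _) h2 h1
  -- The norms are summable, so all but finitely many are below `1` and dominate their squares.
  refine h4.of_norm_bounded_eventually (E := ℝ) ?_
  have h5 := h4.tendsto_cofinite_zero.eventually (gt_mem_nhds one_pos)
  filter_upwards [h5] with n hn
  rw [Real.norm_of_nonneg (sq_nonneg _)]
  nlinarith [norm_nonneg (matrixOp b M (b n))]

end MatrixOperator

/-! ### Spectral theory of block triangular matrices. -/

section TriangularOperator

variable {ι : Type} {H : Type} [NormedAddCommGroup H] [InnerProductSpace ℂ H] [CompleteSpace H]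

theorem summable_norm_matrix_of_le {M N : ι → ι → ℂ}
    (hM : Summable fun p : ι × ι => ‖M p.1 p.2‖) (h : ∀ n p, N n p = M n p ∨ N n p = 0) :
    Summable fun p : ι × ι => ‖N p.1 p.2‖ := by
  refine Summable.of_nonneg_of_le (fun _ => norm_nonneg _) (fun p => ?_) hM
  rcases h p.1 p.2 with h | h <;> simp [h]

/-- A compact operator whose matrix strictly raises a height function has no non-zero spectrum. -/
theorem mem_resolventSet_of_height_lt (b : HilbertBasis ι ℂ H) {M : ι → ι → ℂ}
    (hM : Summable fun p : ι × ι => ‖M p.1 p.2‖) (h : ι → ℕ)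
    (hh : ∀ n p, M n p ≠ 0 → h n < h p) {μ : ℂ} (hμ : μ ≠ 0) :
    μ ∈ resolventSet ℂ (matrixOp b M) := by
  refine ((isCompactOperator_matrixOp b hM).hasEigenvalue_or_mem_resolventSet hμ).resolve_left ?_
  intro hev
  obtain ⟨x, hx⟩ := hev.exists_hasEigenvector
  refine hx.2 (ext_inner_basis b fun p => ?_)
  rw [inner_zero_right]
  have hx1 : matrixOp b M x = μ • x := hx.apply_eq_smul
  -- The coordinate `μ x_p` is a combination of coordinates of strictly smaller height, which vanish
  -- by induction.
  induction hk : h p using Nat.strong_induction_on generalizing p with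
  | _ k ih =>
    have h1 := hasSum_inner_matrixOp b hM x p
    rw [hx1, inner_smul_right] at h1
    have h2 : (fun n => M n p * inner ℂ (b n) x) = fun _ => 0 := by
      funext n
      by_cases hn : M n p = 0
      · rw [hn, zero_mul]
      · rw [ih (h n) (hk ▸ hh n p hn) n rfl, mul_zero]
    rw [h2] at h1
    exact (mul_eq_zero.mp (h1.unique hasSum_zero)).resolve_left hμ

/-- A compact operator whose matrix strictly lowers a height function has no non-zero spectrum. -/
theorem mem_resolventSet_of_lt_height (b : HilbertBasis ι ℂ H) {M : ι → ι → ℂ}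
    (hM : Summable fun p : ι × ι => ‖M p.1 p.2‖) (h : ι → ℕ)
    (hh : ∀ n p, M n p ≠ 0 → h p < h n) {μ : ℂ} (hμ : μ ≠ 0) :
    μ ∈ resolventSet ℂ (matrixOp b M) := by
  have h1 : Summable fun p : ι × ι => ‖conj (M p.2 p.1)‖ := by
    simpa using! ((Equiv.prodComm ι ι).summable_iff (f := fun p : ι × ι => ‖M p.1 p.2‖)).mpr hM
  -- Descending the height gives no well-founded recursion for coordinates, but the adjoint raises
  -- the height.
  have h2 := mem_resolventSet_of_height_lt (M := fun n p => conj (M p n)) b h1 h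
    (fun n p hnp => hh p n (by simpa using hnp)) (μ := conj μ) (by simpa using hμ)
  rw [← adjoint_matrixOp b hM, spectrum.mem_resolventSet_iff] at h2
  rw [spectrum.mem_resolventSet_iff, ← isUnit_star]
  convert! h2 using 1
  rw [star_sub, ← algebraMap_star_comm]
  rfl

theorem eq_zero_of_mem_resolventSet {A : H →L[ℂ] H} {μ : ℂ} (h : μ ∈ resolventSet ℂ A) {x : H}
    (hx : A x = μ • x) : x = 0 := by
  rw [spectrum.mem_resolventSet_iff, ContinuousLinearMap.isUnit_iff_bijective] at h
  refine h.1 ?_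
  simp [hx, Algebra.algebraMap_eq_smul_one]

theorem exists_sub_smul_eq_of_mem_resolventSet {A : H →L[ℂ] H} {μ : ℂ}
    (h : μ ∈ resolventSet ℂ A) (y : H) : ∃ x, A x - μ • x = y := by
  rw [spectrum.mem_resolventSet_iff, ContinuousLinearMap.isUnit_iff_bijective] at h
  obtain ⟨x, hx⟩ := h.2 (-y)
  refine ⟨x, ?_⟩
  have hx' : μ • x - A x = -y := by simpa [Algebra.algebraMap_eq_smul_one] using hx
  rw [← neg_sub, hx', neg_neg]

/-- A matrix that is block triangular for the ordering `R → (R ∪ S)ᶜ → S` of the indices, strictly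
lowers the height within `R`, strictly raises it within `S`, and is diagonal on the middle block. -/
structure IsBlockTriangular (M : ι → ι → ℂ) (S R : Set ι) (h : ι → ℕ) : Prop where
  summable : Summable fun p : ι × ι => ‖M p.1 p.2‖
  of_mem_S : ∀ n p, n ∈ S → M n p ≠ 0 → p ∈ S ∧ h n < h p
  of_mem_R : ∀ n p, p ∈ R → M n p ≠ 0 → n ∈ R ∧ h p < h n
  of_notMem : ∀ n p, n ∉ S → n ∉ R → p ∉ S → M n p ≠ 0 → n = p

namespace IsBlockTriangular

variable {M : ι → ι → ℂ} {S R : Set ι} {h : ι → ℕ}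

/-- The indices of the middle block whose diagonal entry is `μ`. -/
def diagIndices (M : ι → ι → ℂ) (S R : Set ι) (μ : ℂ) : Set ι :=
  {n | n ∉ S ∧ n ∉ R ∧ M n n = μ}

/-- The diagonal of a summable matrix tends to zero, so it takes a non-zero value finitely often. -/
theorem finite_diagIndices (hM : IsBlockTriangular M S R h) {μ : ℂ} (hμ : μ ≠ 0) :
    (diagIndices M S R μ).Finite := by
  have h1 : Summable fun n => ‖M n n‖ :=
    hM.summable.comp_injective (i := fun n => (n, n)) fun m n h => (Prod.ext_iff.mp h).1
  have h2 := h1.tendsto_cofinite_zero.eventually (gt_mem_nhds (norm_pos_iff.mpr hμ))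
  refine (Filter.eventually_cofinite.mp h2).subset fun n hn => ?_
  simp only [Set.mem_ofPred_eq, not_lt]
  rw [hn.2.2]

open Classical in
/-- The block of the matrix with source in `S`. -/
def sBlock (M : ι → ι → ℂ) (S : Set ι) (n p : ι) : ℂ := if n ∈ S then M n p else 0

open Classical in
/-- The block of the matrix with target in `R`. -/
def rBlock (M : ι → ι → ℂ) (R : Set ι) (n p : ι) : ℂ := if p ∈ R then M n p else 0

theorem summable_sBlock (hM : IsBlockTriangular M S R h) :
    Summable fun p : ι × ι => ‖sBlock M S p.1 p.2‖ :=
  summable_norm_matrix_of_le hM.summable fun n p => by unfold sBlock; split_ifs <;> simp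

theorem summable_rBlock (hM : IsBlockTriangular M S R h) :
    Summable fun p : ι × ι => ‖rBlock M R p.1 p.2‖ :=
  summable_norm_matrix_of_le hM.summable fun n p => by unfold rBlock; split_ifs <;> simp

theorem mem_resolventSet_sBlock (hM : IsBlockTriangular M S R h) (b : HilbertBasis ι ℂ H)
    {μ : ℂ} (hμ : μ ≠ 0) : μ ∈ resolventSet ℂ (matrixOp b (sBlock M S)) := by
  refine mem_resolventSet_of_height_lt b hM.summable_sBlock h (fun n p hnp => ?_) hμ
  unfold sBlock at hnp
  split_ifs at hnp with hn
  · exact (hM.of_mem_S n p hn hnp).2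
  · exact absurd rfl hnp

theorem mem_resolventSet_rBlock (hM : IsBlockTriangular M S R h) (b : HilbertBasis ι ℂ H)
    {μ : ℂ} (hμ : μ ≠ 0) : μ ∈ resolventSet ℂ (matrixOp b (rBlock M R)) := by
  refine mem_resolventSet_of_lt_height b hM.summable_rBlock h (fun n p hnp => ?_) hμ
  unfold rBlock at hnp
  split_ifs at hnp with hn
  · exact (hM.of_mem_R n p hn hnp).2
  · exact absurd rfl hnp

theorem matrixOp_eq_sBlock (hM : IsBlockTriangular M S R h) (b : HilbertBasis ι ℂ H) {x : H}
    (hx : ∀ n ∉ S, inner ℂ (b n) x = 0) : matrixOp b M x = matrixOp b (sBlock M S) x := by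
  refine ext_inner_basis b fun p => (hasSum_inner_matrixOp b hM.summable x p).unique ?_
  convert! hasSum_inner_matrixOp b hM.summable_sBlock x p using 2 with n
  by_cases hn : n ∈ S
  · simp [sBlock, hn]
  · simp [hx n hn]

theorem inner_sBlock_eq_zero (hM : IsBlockTriangular M S R h) (b : HilbertBasis ι ℂ H) (x : H)
    {p : ι} (hp : p ∉ S) : inner ℂ (b p) (matrixOp b (sBlock M S) x) = 0 := by
  refine (hasSum_inner_matrixOp b hM.summable_sBlock x p).unique ?_
  convert! hasSum_zero using 2 with n
  rw [mul_eq_zero]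
  left
  by_contra hnp
  unfold sBlock at hnp
  split_ifs at hnp with hn
  · exact hp (hM.of_mem_S n p hn hnp).1
  · exact hnp rfl

/-- If `(A - μ) x` vanishes on `R`, then so does `x`. -/
theorem inner_eq_zero_of_mem_R (hM : IsBlockTriangular M S R h) (b : HilbertBasis ι ℂ H) {μ : ℂ}
    (hμ : μ ≠ 0) {x : H} (hx : ∀ n ∈ R, inner ℂ (b n) (matrixOp b M x - μ • x) = 0)
    {n : ι} (hn : n ∈ R) : inner ℂ (b n) x = 0 := by
  have h1 : ∀ p ∈ R, inner ℂ (b p) (matrixOp b (rBlock M R) x) = μ * inner ℂ (b p) x := by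
    intro p hp
    have h2 := hx p hp
    rw [inner_sub_right, inner_smul_right, sub_eq_zero] at h2
    rw [← h2]
    refine (hasSum_inner_matrixOp b hM.summable_rBlock x p).unique ?_
    convert! hasSum_inner_matrixOp b hM.summable x p using 2
    simp [rBlock, hp]
  have h3 : ∀ p ∉ R, ∀ y : H, inner ℂ (b p) (matrixOp b (rBlock M R) y) = 0 := by
    intro p hp y
    refine (hasSum_inner_matrixOp b hM.summable_rBlock y p).unique ?_
    convert! hasSum_zero using 2
    simp [rBlock, hp]
  -- The `R`-coordinates of `A x` depend only on those of `x`. By `h1` and `h3` the vector on which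
  -- the block acts here is `μ` times the projection of `x` to `R`, so it is an eigenvector of the
  -- block unless it is zero.
  have h4 : matrixOp b (rBlock M R) (matrixOp b (rBlock M R) x) =
      μ • matrixOp b (rBlock M R) x := by
    refine ext_inner_basis b fun p => ?_
    rw [inner_smul_right]
    by_cases hp : p ∈ R
    · refine (hasSum_inner_matrixOp b hM.summable_rBlock _ p).unique ?_
      convert! (hasSum_inner_matrixOp b hM.summable_rBlock x p).mul_left μ using 2 with m
      by_cases hm : m ∈ R
      · rw [h1 m hm]; ring
      · have : rBlock M R m p = 0 := by
          by_contra hne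
          simp only [rBlock, hp, if_true] at hne
          exact hm (hM.of_mem_R m p hp hne).1
        rw [this]; ring
    · rw [h3 p hp, h3 p hp, mul_zero]
  have h5 := eq_zero_of_mem_resolventSet (hM.mem_resolventSet_rBlock b hμ) h4
  have h6 := h1 n hn
  rw [h5, inner_zero_right] at h6
  exact (mul_eq_zero.mp h6.symm).resolve_left hμ

/-- Sources in `S` cannot reach `p`, sources in `R` carry no mass, and a source in the middle
reaches only itself outside `S`. -/
theorem inner_matrixOp_of_middle (hM : IsBlockTriangular M S R h) (b : HilbertBasis ι ℂ H) {x : H}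
    (hx : ∀ n ∈ R, inner ℂ (b n) x = 0) {p : ι} (hpS : p ∉ S) :
    inner ℂ (b p) (matrixOp b M x) = M p p * inner ℂ (b p) x := by
  refine (hasSum_inner_matrixOp b hM.summable x p).unique (hasSum_single p fun n hn => ?_)
  by_cases hnR : n ∈ R
  · rw [hx n hnR, mul_zero]
  rw [mul_eq_zero]
  left
  by_contra hnp
  by_cases hnS : n ∈ S
  · exact hpS (hM.of_mem_S n p hnS hnp).1
  · exact hn (hM.of_notMem n p hnS hnR hpS hnp)

/-- There is an eigenvector for each diagonal entry of the middle block. -/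
theorem exists_eigenvector (hM : IsBlockTriangular M S R h) (b : HilbertBasis ι ℂ H) {μ : ℂ}
    (hμ : μ ≠ 0) {j : ι} (hj : j ∈ diagIndices M S R μ) :
    ∃ v : H, matrixOp b M v = μ • v ∧ ∀ n ∉ S, inner ℂ (b n) v = inner ℂ (b n) (b j) := by
  -- The defect of `b j` as an eigenvector lies in `S`, where `A - μ` is invertible; `s` is the
  -- correction cancelling it.
  obtain ⟨s, hs⟩ := exists_sub_smul_eq_of_mem_resolventSet (hM.mem_resolventSet_sBlock b hμ)
    (-(matrixOp b M (b j) - μ • b j))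
  have h1 : ∀ n ∉ S, inner ℂ (b n) s = 0 := by
    intro n hn
    have h2 := congrArg (inner ℂ (b n)) hs
    have hjR : ∀ m ∈ R, inner ℂ (b m) (b j) = 0 := fun m hm =>
      b.orthonormal.2 fun h => hj.2.1 (h ▸ hm)
    rw [inner_sub_right, inner_smul_right, hM.inner_sBlock_eq_zero b s hn, inner_neg_right,
      inner_sub_right, inner_smul_right, hM.inner_matrixOp_of_middle b hjR hn] at h2
    have h3 : M n n * inner ℂ (b n) (b j) = μ * inner ℂ (b n) (b j) := by
      by_cases hnj : n = j
      · rw [hnj, hj.2.2]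
      · rw [b.orthonormal.2 hnj, mul_zero, mul_zero]
    rw [h3, sub_self, neg_zero, zero_sub, neg_eq_zero] at h2
    exact (mul_eq_zero.mp h2).resolve_left hμ
  refine ⟨b j + s, ?_, fun n hn => by rw [inner_add_right, h1 n hn, add_zero]⟩
  rw [map_add, hM.matrixOp_eq_sBlock b h1, sub_eq_iff_eq_add.mp hs, smul_add]
  abel

/-- Induction peels off one factor `A - μ`. It is injective on the `R`-coordinates; once these
vanish, it multiplies a middle coordinate by `M n n - μ`, which is non-zero off `diagIndices`. -/
theorem inner_eq_zero_of_pow (hM : IsBlockTriangular M S R h) (b : HilbertBasis ι ℂ H) {μ : ℂ}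
    (hμ : μ ≠ 0) (k : ℕ) {x : H}
    (hx : ((((matrixOp b M : H →L[ℂ] H) : Module.End ℂ H) - μ • 1) ^ k : Module.End ℂ H) x = 0) :
    (∀ n ∈ R, inner ℂ (b n) x = 0) ∧
      ∀ n ∉ S, n ∉ diagIndices M S R μ → inner ℂ (b n) x = 0 := by
  induction k generalizing x with
  | zero =>
    have hx0 : x = 0 := hx
    simp [hx0]
  | succ k ih =>
    obtain ⟨h1, h2⟩ := ih (x := matrixOp b M x - μ • x) (by rw [pow_succ] at hx; exact hx)
    have h3 : ∀ n ∈ R, inner ℂ (b n) x = 0 := fun n hn => hM.inner_eq_zero_of_mem_R b hμ h1 hn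
    refine ⟨h3, fun n hn hnd => ?_⟩
    by_cases hnR : n ∈ R
    · exact h3 n hnR
    have h4 := h2 n hn hnd
    rw [inner_sub_right, inner_smul_right, hM.inner_matrixOp_of_middle b h3 hn, ← sub_mul] at h4
    exact (mul_eq_zero.mp h4).resolve_left fun h5 => hnd ⟨hn, hnR, sub_eq_zero.mp h5⟩

theorem eq_zero_of_pow_of_supported (hM : IsBlockTriangular M S R h) (b : HilbertBasis ι ℂ H)
    {μ : ℂ} (hμ : μ ≠ 0) (k : ℕ) {x : H}
    (hx : ((((matrixOp b M : H →L[ℂ] H) : Module.End ℂ H) - μ • 1) ^ k : Module.End ℂ H) x = 0)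
    (hS : ∀ n ∉ S, inner ℂ (b n) x = 0) : x = 0 := by
  induction k generalizing x with
  | zero => exact hx
  | succ k ih =>
    have h1 := hM.matrixOp_eq_sBlock b hS
    have h2 := ih (x := matrixOp b M x - μ • x) (by rw [pow_succ] at hx; exact hx) fun n hn => by
      rw [inner_sub_right, inner_smul_right, hS n hn, h1, hM.inner_sBlock_eq_zero b x hn]
      simp
    rw [h1, sub_eq_zero] at h2
    exact eq_zero_of_mem_resolventSet (hM.mem_resolventSet_sBlock b hμ) h2

/-- The generalised eigenspace of a non-zero `μ` has a basis indexed by the diagonal entries `μ` of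
the middle block. -/
theorem finrank_genEigenspace (hM : IsBlockTriangular M S R h) (b : HilbertBasis ι ℂ H) {μ : ℂ}
    (hμ : μ ≠ 0) :
    FiniteDimensional ℂ (genEigenspace (matrixOp b M) μ) ∧
      Module.finrank ℂ (genEigenspace (matrixOp b M) μ) = (diagIndices M S R μ).ncard := by
  classical
  have hfin := hM.finite_diagIndices hμ
  have : Fintype (diagIndices M S R μ) := hfin.fintype
  choose v hv1 hv2 using fun j : diagIndices M S R μ => hM.exists_eigenvector b hμ j.2
  have hcoord : ∀ (c : diagIndices M S R μ → ℂ) (i : diagIndices M S R μ),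
      inner ℂ (b i) (∑ j, c j • v j) = c i := by
    intro c i
    rw [inner_sum, Finset.sum_eq_single i]
    · rw [inner_smul_right, hv2 i i i.2.1, orthonormal_iff_ite.mp b.orthonormal]
      simp
    · intro j _ hji
      rw [inner_smul_right, hv2 j i i.2.1, b.orthonormal.2 fun h => hji (Subtype.ext h.symm),
        mul_zero]
    · simp
  have hli : LinearIndependent ℂ v := by
    rw [Fintype.linearIndependent_iff]
    intro c hc i
    rw [← hcoord c i, hc, inner_zero_right]
  have hspan : genEigenspace (matrixOp b M) μ = Submodule.span ℂ (Set.range v) := by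
    have hle : Submodule.span ℂ (Set.range v) ≤ genEigenspace (matrixOp b M) μ := by
      rw [Submodule.span_le]
      rintro _ ⟨j, rfl⟩
      refine (Module.End.mem_maxGenEigenspace _ _ _).mpr ⟨1, ?_⟩
      rw [pow_one]
      exact sub_eq_zero.mpr (hv1 j)
    refine le_antisymm (fun x hx => ?_) hle
    -- Subtracting this combination removes every coordinate outside `S`. The difference is still a
    -- generalised eigenvector, hence zero.
    have hsum : ∑ j : diagIndices M S R μ, inner ℂ (b j) x • v j ∈
        Submodule.span ℂ (Set.range v) :=
      Submodule.sum_mem _ fun j _ => Submodule.smul_mem _ _ (Submodule.subset_span ⟨j, rfl⟩)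
    have hdiff := Submodule.sub_mem _ hx (hle hsum)
    obtain ⟨k, hk⟩ := (Module.End.mem_maxGenEigenspace _ _ _).mp hdiff
    have h1 := hM.inner_eq_zero_of_pow b hμ k hk
    have h2 := hM.eq_zero_of_pow_of_supported b hμ k hk fun n hn => by
      by_cases hnd : n ∈ diagIndices M S R μ
      · rw [inner_sub_right, hcoord (fun j => inner ℂ (b j) x) ⟨n, hnd⟩, sub_self]
      · exact h1.2 n hn hnd
    rw [sub_eq_zero.mp h2]
    exact hsum
  rw [hspan]
  refine ⟨FiniteDimensional.span_of_finite ℂ (Set.finite_range v), ?_⟩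
  rw [finrank_span_eq_card hli, Set.ncard_eq_toFinset_card', Set.toFinset_card]

theorem hasEigenvalue_iff (hM : IsBlockTriangular M S R h) (b : HilbertBasis ι ℂ H) {μ : ℂ}
    (hμ : μ ≠ 0) :
    Module.End.HasEigenvalue ((matrixOp b M : H →L[ℂ] H) : Module.End ℂ H) μ ↔
      (diagIndices M S R μ).Nonempty := by
  constructor
  · intro hev
    obtain ⟨x, hx⟩ := hev.exists_hasEigenvector
    have h0 : ((((matrixOp b M : H →L[ℂ] H) : Module.End ℂ H) - μ • 1) ^ 1 : Module.End ℂ H) x = 0 := by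
      rw [pow_one]
      exact sub_eq_zero.mpr hx.apply_eq_smul
    by_contra hne
    refine hx.2 (hM.eq_zero_of_pow_of_supported b hμ 1 h0 fun n hn => ?_)
    exact (hM.inner_eq_zero_of_pow b hμ 1 h0).2 n hn fun h => hne ⟨n, h⟩
  · rintro ⟨j, hj⟩
    obtain ⟨v, hv1, hv2⟩ := hM.exists_eigenvector b hμ hj
    refine Module.End.hasEigenvalue_of_hasEigenvector (x := v)
      ⟨Module.End.mem_eigenspace_iff.mpr hv1, fun hv => ?_⟩
    have h1 := hv2 j hj.1
    rw [hv, inner_zero_right, inner_self_eq_norm_sq_to_K, b.orthonormal.1] at h1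
    simp at h1

theorem mem_spectrum_iff (hM : IsBlockTriangular M S R h) (b : HilbertBasis ι ℂ H) {μ : ℂ}
    (hμ : μ ≠ 0) : μ ∈ spectrum ℂ (matrixOp b M) ↔ (diagIndices M S R μ).Nonempty := by
  rw [← (isCompactOperator_matrixOp b hM.summable).hasEigenvalue_iff_mem_spectrum hμ,
    hM.hasEigenvalue_iff b hμ]

end IsBlockTriangular

/-- An invertible compact operator would make the identity compact and the space finite-dimensional.
-/
theorem zero_mem_spectrum_matrixOp [Infinite ι] (b : HilbertBasis ι ℂ H) {M : ι → ι → ℂ}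
    (hM : Summable fun p : ι × ι => ‖M p.1 p.2‖) : (0 : ℂ) ∈ spectrum ℂ (matrixOp b M) := by
  rw [spectrum.zero_mem_iff]
  rintro ⟨u, hu⟩
  have h1 : IsCompactOperator (id : H → H) := by
    have h2 := (isCompactOperator_matrixOp b hM).clm_comp ((u⁻¹ : (H →L[ℂ] H)ˣ) : H →L[ℂ] H)
    convert! h2 using 1
    funext x
    have h3 : ((u⁻¹ : (H →L[ℂ] H)ˣ) : H →L[ℂ] H) * (u : H →L[ℂ] H) = 1 := u.inv_mul
    rw [hu] at h3
    exact (DFunLike.congr_fun h3 x).symm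
  have h2 : FiniteDimensional ℂ H := FiniteDimensional.of_isCompactOperator_id h1
  have h3 := b.orthonormal.linearIndependent.finite
  exact not_finite ι

end TriangularOperator

/-! ### Fourier coefficients on the circle as contour integrals. -/

/-- The Fourier coefficients of a function on the circle. -/
def circleCoeff (g : Circle → ℂ) (k : ℤ) : ℂ :=
  (1 / (2 * (Real.pi : ℂ))) * ∫ θ in (0 : ℝ)..2 * Real.pi,
    g (Circle.exp θ) * Complex.exp (-Complex.I * ((k : ℂ) * (θ : ℂ)))

theorem circleCoeff_eq_circleIntegral (F : ℂ → ℂ) (k : ℤ) :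
    circleCoeff (fun z => F z) k =
      (2 * Real.pi * Complex.I : ℂ)⁻¹ * ∮ z in C(0, 1), z ^ (-k - 1) * F z := by
  have h : ∀ θ : ℝ, deriv (circleMap 0 1) θ • ((circleMap 0 1 θ) ^ (-k - 1) * F (circleMap 0 1 θ)) =
      Complex.I * (F (Circle.exp θ) * Complex.exp (-Complex.I * ((k : ℂ) * (θ : ℂ)))) := by
    intro θ
    have h1 : circleMap 0 1 θ = Circle.exp θ := by simp [circleMap]
    have h2 : (circleMap 0 1 θ) ^ (-k - 1) * circleMap 0 1 θ =
        Complex.exp (-Complex.I * ((k : ℂ) * (θ : ℂ))) := by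
      have h0 : circleMap 0 1 θ ≠ 0 := by rw [h1]; exact Circle.coe_ne_zero _
      rw [← zpow_add_one₀ h0, sub_add_cancel, h1, Circle.coe_exp, ← Complex.exp_int_mul]
      congr 1
      push_cast
      ring
    rw [deriv_circleMap, smul_eq_mul, ← h2, ← h1]
    ring
  rw [circleIntegral]
  simp only [h]
  rw [intervalIntegral.integral_const_mul, circleCoeff, ← mul_assoc]
  congr 1
  field_simp

theorem circleCoeff_eq_zero_of_neg {F : ℂ → ℂ}
    (hF : DifferentiableOn ℂ F (Metric.closedBall 0 1)) {k : ℤ} (hk : k < 0) :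
    circleCoeff (fun z => F z) k = 0 := by
  obtain ⟨j, hj⟩ := Int.eq_ofNat_of_zero_le (show 0 ≤ -k - 1 by omega)
  rw [circleCoeff_eq_circleIntegral, hj]
  simp only [zpow_natCast]
  have hd : DifferentiableOn ℂ (fun z => z ^ j * F z) (Metric.closedBall 0 1) :=
    (differentiableOn_id.pow j).mul hF
  rw [(hd.mono Metric.closure_ball_subset_closedBall).diffContOnCl.circleIntegral_eq_zero
    zero_le_one, mul_zero]

theorem circleCoeff_zero {F : ℂ → ℂ} (hF : DifferentiableOn ℂ F (Metric.closedBall 0 1)) :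
    circleCoeff (fun z => F z) 0 = F 0 := by
  have h := hF.circleIntegral_sub_inv_smul (w := 0) (by simp)
  rw [circleCoeff_eq_circleIntegral]
  simp only [sub_zero, smul_eq_mul] at h
  simp only [neg_zero, zero_sub, zpow_neg_one]
  rw [h, inv_mul_cancel_left₀ Complex.two_pi_I_ne_zero]

theorem norm_circleCoeff_le {F : ℂ → ℂ} (hF : DifferentiableOn ℂ F (Metric.closedBall 0 1))
    {r C : ℝ} (hr : 0 < r) (hr1 : r ≤ 1) (hC : ∀ z, ‖z‖ = r → ‖F z‖ ≤ C) (k : ℕ) :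
    ‖circleCoeff (fun z => F z) k‖ ≤ (r⁻¹) ^ k * C := by
  have hd : DifferentiableOn ℂ (fun z : ℂ => z ^ (-(k : ℤ) - 1) * F z)
      (Metric.closedBall 0 1 \ {0}) := fun z hz =>
    ((differentiableAt_zpow.mpr (Or.inl hz.2)).differentiableWithinAt).mul
      ((hF z hz.1).mono Set.sdiff_subset)
  -- The integrand is holomorphic away from `0`, so the contour may shrink to radius `r`.
  have h1 : (∮ z in C(0, 1), z ^ (-(k : ℤ) - 1) * F z) =
      ∮ z in C(0, r), z ^ (-(k : ℤ) - 1) * F z := by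
    refine Complex.circleIntegral_eq_of_differentiable_on_annulus_off_countable hr hr1
      Set.countable_empty (hd.continuousOn.mono ?_) ?_
    · refine Set.sdiff_subset_sdiff_right ?_
      simpa using hr
    · rintro z ⟨⟨hz1, hz2⟩, -⟩
      have hz0 : z ∈ ({0}ᶜ : Set ℂ) := by
        rintro rfl
        exact hz2 (by simp [hr.le])
      refine hd.differentiableAt (Filter.mem_of_superset (Filter.inter_mem
        (Metric.isOpen_ball.mem_nhds hz1) (isOpen_compl_singleton.mem_nhds hz0))
        fun w hw => ⟨Metric.ball_subset_closedBall hw.1, hw.2⟩)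
  have h2 := circleIntegral.norm_two_pi_i_inv_smul_integral_le_of_norm_le_const (c := 0) (R := r)
    (f := fun z : ℂ => z ^ (-(k : ℤ) - 1) * F z) (C := r ^ (-(k : ℤ) - 1) * C) hr.le
    (fun z hz => by
      have hz' : ‖z‖ = r := by simpa using hz
      rw [norm_mul, norm_zpow, hz']
      exact mul_le_mul_of_nonneg_left (hC z hz') (by positivity))
  rw [circleCoeff_eq_circleIntegral, h1, ← smul_eq_mul]
  refine h2.trans (le_of_eq ?_)
  rw [← mul_assoc, ← zpow_one_add₀ hr.ne']
  congr 1
  rw [show 1 + (-(k : ℤ) - 1) = -(k : ℤ) by ring, zpow_neg, zpow_natCast, inv_pow]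

theorem circleCoeff_conj (g : Circle → ℂ) (k : ℤ) :
    circleCoeff (fun z => conj (g z)) (-k) = conj (circleCoeff g k) := by
  unfold circleCoeff
  rw [map_mul, ← intervalIntegral.intervalIntegral_conj]
  congr 1
  · simp [Complex.conj_ofNat]
  · refine intervalIntegral.integral_congr fun θ _ => ?_
    simp [← Complex.exp_conj]

/-! ### Fourier coefficients of powers of the Blaschke factor. -/

section BlaschkeCoefficients

variable (lam : ℂ)

/-- The Blaschke factor as a function on the plane. -/
def blaschkeC (z : ℂ) : ℂ := (z - lam) / (1 - conj lam * z)

variable {lam}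

theorem blaschkeC_den_ne_zero (hlam : ‖lam‖ < 1) {z : ℂ} (hz : ‖z‖ ≤ 1) :
    1 - conj lam * z ≠ 0 := by
  intro h
  have h1 : ‖conj lam * z‖ = 1 := by rw [← sub_eq_zero.mp h, norm_one]
  rw [norm_mul, RCLike.norm_conj] at h1
  nlinarith [norm_nonneg lam, norm_nonneg z]

theorem differentiableOn_blaschkeC (hlam : ‖lam‖ < 1) :
    DifferentiableOn ℂ (blaschkeC lam) (Metric.closedBall 0 1) := by
  intro z hz
  have hne := blaschkeC_den_ne_zero hlam (z := z) (by simpa using hz)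
  unfold blaschkeC
  exact DifferentiableAt.differentiableWithinAt (by fun_prop (disch := assumption))

theorem norm_blaschkeC_lt_one (hlam : ‖lam‖ < 1) {z : ℂ} (hz : ‖z‖ < 1) :
    ‖blaschkeC lam z‖ < 1 := by
  have hne := blaschkeC_den_ne_zero hlam hz.le
  rw [blaschkeC, norm_div, div_lt_one (norm_pos_iff.mpr hne), ← sq_lt_sq₀ (norm_nonneg _)
    (norm_nonneg _), Complex.sq_norm, Complex.sq_norm]
  have h1 : Complex.normSq (1 - conj lam * z) - Complex.normSq (z - lam) =
      (1 - ‖z‖ ^ 2) * (1 - ‖lam‖ ^ 2) := by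
    rw [Complex.sq_norm, Complex.sq_norm]
    simp [Complex.normSq_apply]
    ring
  have h2 : 0 < (1 - ‖z‖ ^ 2) * (1 - ‖lam‖ ^ 2) := by
    have := norm_nonneg z
    have := norm_nonneg lam
    apply mul_pos <;> nlinarith
  linarith

theorem exists_norm_blaschkeC_le (hlam : ‖lam‖ < 1) {r : ℝ} (hr : 0 < r) (hr1 : r < 1) :
    ∃ ρ, 0 < ρ ∧ ρ < 1 ∧ ∀ z, ‖z‖ = r → ‖blaschkeC lam z‖ ≤ ρ := by
  have hsub : Metric.sphere (0 : ℂ) r ⊆ Metric.closedBall 0 1 :=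
    Metric.sphere_subset_closedBall.trans (Metric.closedBall_subset_closedBall hr1.le)
  obtain ⟨z, hz, hmax⟩ := (isCompact_sphere (0 : ℂ) r).exists_isMaxOn
    (NormedSpace.sphere_nonempty.mpr hr.le)
    ((differentiableOn_blaschkeC hlam).continuousOn.mono hsub).norm
  have hz' : ‖z‖ = r := by simpa using hz
  -- The `1 / 2` only secures `0 < ρ`.
  refine ⟨max ‖blaschkeC lam z‖ (1 / 2), by positivity,
    max_lt (norm_blaschkeC_lt_one hlam (hz' ▸ hr1)) (by norm_num), fun w hw => ?_⟩
  exact (hmax (by simpa using hw)).trans (le_max_left _ _)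

/-- The Fourier coefficients of the `m`-th power of the Blaschke factor. -/
def blaschkeCoeff (lam : ℂ) (hlam : ‖lam‖ < 1) (m k : ℤ) : ℂ :=
  circleCoeff (fun z => (blaschke lam hlam z : ℂ) ^ m) k

theorem blaschkeCoeff_natCast (hlam : ‖lam‖ < 1) (m : ℕ) (k : ℤ) :
    blaschkeCoeff lam hlam m k = circleCoeff (fun z => (fun w => blaschkeC lam w ^ m) z) k := by
  unfold blaschkeCoeff
  simp only [zpow_natCast]
  rfl

/-- On the circle `B` is unimodular, so conjugation inverts it; this reduces negative powers to
positive ones. -/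
theorem blaschkeCoeff_neg (hlam : ‖lam‖ < 1) (m k : ℤ) :
    blaschkeCoeff lam hlam (-m) (-k) = conj (blaschkeCoeff lam hlam m k) := by
  unfold blaschkeCoeff
  rw [← circleCoeff_conj]
  congr 1
  funext z
  rw [map_zpow₀, ← Circle.coe_inv_eq_conj, Circle.coe_inv, inv_zpow, zpow_neg]

theorem blaschkeCoeff_eq_zero (hlam : ‖lam‖ < 1) {m k : ℤ} (hm : 0 ≤ m) (hk : k < 0) :
    blaschkeCoeff lam hlam m k = 0 := by
  obtain ⟨j, rfl⟩ := Int.eq_ofNat_of_zero_le hm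
  rw [blaschkeCoeff_natCast]
  exact circleCoeff_eq_zero_of_neg ((differentiableOn_blaschkeC hlam).pow j) hk

theorem blaschkeCoeff_eq_zero' (hlam : ‖lam‖ < 1) {m k : ℤ} (hm : m ≤ 0) (hk : 0 < k) :
    blaschkeCoeff lam hlam m k = 0 := by
  rw [← neg_neg m, ← neg_neg k, blaschkeCoeff_neg,
    blaschkeCoeff_eq_zero hlam (by omega) (by omega), map_zero]

theorem blaschkeCoeff_zero_right (hlam : ‖lam‖ < 1) (m : ℤ) :
    blaschkeCoeff lam hlam m 0 = eigenvalueList lam m := by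
  have h : ∀ j : ℕ, blaschkeCoeff lam hlam j 0 = (-lam) ^ j := fun j => by
    rw [blaschkeCoeff_natCast]
    refine (circleCoeff_zero ((differentiableOn_blaschkeC hlam).pow j)).trans ?_
    simp [blaschkeC]
  unfold eigenvalueList
  split_ifs with hm
  · rw [← h, Int.natAbs_of_nonneg hm]
  · have h1 := blaschkeCoeff_neg hlam (m.natAbs : ℤ) 0
    rw [h, neg_zero, show -(m.natAbs : ℤ) = m by omega] at h1
    simpa using h1

/-- Moving the contour inside the disc, where `|B| ≤ ρ < 1`, buys decay in the power `m` at the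
price of growth in the frequency `k`. -/
theorem exists_norm_blaschkeCoeff_le (hlam : ‖lam‖ < 1) {r : ℝ} (hr : 0 < r) (hr1 : r < 1) :
    ∃ ρ, 0 < ρ ∧ ρ < 1 ∧
      ∀ m k, ‖blaschkeCoeff lam hlam m k‖ ≤ (r⁻¹) ^ k.natAbs * ρ ^ m.natAbs := by
  obtain ⟨ρ, h0, h1, hρ⟩ := exists_norm_blaschkeC_le hlam hr hr1
  have hpos : ∀ (m : ℕ) (k : ℤ),
      ‖blaschkeCoeff lam hlam m k‖ ≤ (r⁻¹) ^ k.natAbs * ρ ^ m := by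
    intro m k
    rcases lt_or_ge k 0 with hk | hk
    · rw [blaschkeCoeff_eq_zero hlam (by omega) hk, norm_zero]
      positivity
    · obtain ⟨j, rfl⟩ := Int.eq_ofNat_of_zero_le hk
      rw [blaschkeCoeff_natCast]
      refine norm_circleCoeff_le ((differentiableOn_blaschkeC hlam).pow m) hr hr1.le ?_ j
      intro z hz
      rw [Pi.pow_apply, norm_pow]
      exact pow_le_pow_left₀ (norm_nonneg _) (hρ z hz) m
  refine ⟨ρ, h0, h1, fun m k => ?_⟩
  obtain ⟨j, rfl | rfl⟩ := m.eq_nat_or_neg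
  · simpa using hpos j k
  · have h2 := blaschkeCoeff_neg hlam (j : ℤ) (-k)
    rw [neg_neg] at h2
    rw [h2, RCLike.norm_conj]
    simpa using hpos j (-k)

end BlaschkeCoefficients

/-! ### Decrease of the weight exponent along transitions. -/

/-- The exponent `|n_s| - |n_u|`, so that the weight is `exp (2 a (|n_s| - |n_u|))`. -/
def growth (n : ℤ × ℤ) : ℝ := |stableCoord n| - |unstableCoord n|

theorem weight_eq (a : ℝ) (n : ℤ × ℤ) : weight a n = Real.exp (2 * a * growth n) := by
  unfold weight growth
  congr 1
  ring

theorem unstableCoord_eq (n : ℤ × ℤ) : unstableCoord n = Real.goldenRatio * n.1 + n.2 := by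
  rw [unstableCoord, Real.goldenRatio_sq]
  ring

theorem stableCoord_eq (n : ℤ × ℤ) : stableCoord n = n.1 - Real.goldenRatio * n.1 + n.2 := by
  have h : (Real.goldenRatio ^ 2)⁻¹ = 2 - Real.goldenRatio := by
    refine inv_eq_of_mul_eq_one_right ?_
    linear_combination (1 - Real.goldenRatio) * Real.goldenRatio_sq
  rw [stableCoord, h]
  ring

theorem growth_neg (n : ℤ × ℤ) : growth (-n) = growth n := by
  have h1 : stableCoord (-n) = -stableCoord n := by
    rw [stableCoord_eq, stableCoord_eq]
    push_cast [Prod.fst_neg, Prod.snd_neg]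
    ring
  have h2 : unstableCoord (-n) = -unstableCoord n := by
    rw [unstableCoord_eq, unstableCoord_eq]
    push_cast [Prod.fst_neg, Prod.snd_neg]
    ring
  rw [growth, h1, h2, abs_neg, abs_neg, growth]

theorem goldenRatio_bounds : 1.6 < Real.goldenRatio ∧ Real.goldenRatio < 1.62 := by
  have h := Real.goldenRatio_sq
  have h1 := Real.one_lt_goldenRatio
  constructor <;> nlinarith

/-- Here `n` and `x` are the first coordinates of source and target, `m` is the sum of the source
coordinates, and `p`, `q` stand for `φ n`, `φ x`. Replacing `φ` by rational bounds makes the claim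
linear once the signs of `n`, `x` and the four absolute values are fixed. -/
theorem growth_drop_aux {n x m p q : ℝ} (hm : 0 ≤ m) (hx : n ≤ x)
    (hn1 : 0 ≤ n → 1.6 * n ≤ p ∧ p ≤ 1.62 * n) (hn2 : n ≤ 0 → 1.62 * n ≤ p ∧ p ≤ 1.6 * n)
    (hx1 : 0 ≤ x → 1.6 * x ≤ q ∧ q ≤ 1.62 * x) (hx2 : x ≤ 0 → 1.62 * x ≤ q ∧ q ≤ 1.6 * x)
    (hd : 1.6 * (x - n) ≤ q - p) :
    x - n ≤ (|n - p + (m - n)| - |p + (m - n)|) - (|x - q + m| - |q + m|) ∧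
      |n| - 2 * m ≤ (|n - p + (m - n)| - |p + (m - n)|) - (|x - q + m| - |q + m|) := by
  rcases le_total 0 n with h | h <;> rcases le_total 0 x with h' | h' <;>
    simp only [h, h', abs_of_nonneg, abs_of_nonpos, forall_const] at hn1 hn2 hx1 hx2 ⊢ <;>
    rcases abs_cases (n - p + (m - n)) with ⟨e1, _⟩ | ⟨e1, _⟩ <;>
    rcases abs_cases (p + (m - n)) with ⟨e2, _⟩ | ⟨e2, _⟩ <;>
    rcases abs_cases (x - q + m) with ⟨e3, _⟩ | ⟨e3, _⟩ <;>
    rcases abs_cases (q + m) with ⟨e4, _⟩ | ⟨e4, _⟩ <;>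
    rw [e1, e2, e3, e4] <;> constructor <;> linarith

theorem growth_drop_of_nonneg {n p : ℤ × ℤ} (hm : 0 ≤ n.1 + n.2) (hp : p.2 = n.1 + n.2)
    (hk : n.1 ≤ p.1) :
    |((p.1 - n.1 : ℤ) : ℝ)| ≤ growth n - growth p ∧
      |(n.1 : ℝ)| - 2 * |((n.1 + n.2 : ℤ) : ℝ)| ≤ growth n - growth p := by
  obtain ⟨b1, b2⟩ := goldenRatio_bounds
  have hk' : (n.1 : ℝ) ≤ p.1 := by exact_mod_cast hk
  have hm' : (0 : ℝ) ≤ n.1 + n.2 := by exact_mod_cast hm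
  have key : ∀ t : ℝ, (0 ≤ t → 1.6 * t ≤ Real.goldenRatio * t ∧ Real.goldenRatio * t ≤ 1.62 * t) ∧
      (t ≤ 0 → 1.62 * t ≤ Real.goldenRatio * t ∧ Real.goldenRatio * t ≤ 1.6 * t) := fun t =>
    ⟨fun h => ⟨by nlinarith, by nlinarith⟩, fun h => ⟨by nlinarith, by nlinarith⟩⟩
  have h := growth_drop_aux hm' hk' (key n.1).1 (key n.1).2 (key p.1).1 (key p.1).2
    (by nlinarith)
  have e : (n.1 : ℝ) + n.2 - n.1 = n.2 := by ring
  have hp' : (p.2 : ℝ) = n.1 + n.2 := by exact_mod_cast hp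
  rw [growth, growth, stableCoord_eq, stableCoord_eq, unstableCoord_eq, unstableCoord_eq, hp']
  rw [e] at h
  push_cast
  rwa [abs_of_nonneg (sub_nonneg.mpr hk'), abs_of_nonneg hm']

/-- The exponent drops along the transitions of the composition operator. -/
theorem growth_drop {n p : ℤ × ℤ} (hp : p.2 = n.1 + n.2)
    (hk : 0 ≤ n.1 + n.2 ∧ n.1 ≤ p.1 ∨ n.1 + n.2 ≤ 0 ∧ p.1 ≤ n.1) :
    |((p.1 - n.1 : ℤ) : ℝ)| ≤ growth n - growth p ∧
      |(n.1 : ℝ)| - 2 * |((n.1 + n.2 : ℤ) : ℝ)| ≤ growth n - growth p := by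
  rcases hk with ⟨hm, hk⟩ | ⟨hm, hk⟩
  · exact growth_drop_of_nonneg hm hp hk
  · have h := growth_drop_of_nonneg (n := -n) (p := -p) (by simp; omega) (by simp; omega)
      (by simpa using hk)
    rw [growth_neg, growth_neg] at h
    have e1 : (-p).1 - (-n).1 = -(p.1 - n.1) := by simp; ring
    have e2 : (-n).1 + (-n).2 = -(n.1 + n.2) := by simp; ring
    rw [e1, e2] at h
    simpa only [Int.cast_neg, abs_neg, Prod.fst_neg] using h

/-! ### The matrix of the composition operator: decay and block structure. -/

/-- The matrix of the composition operator in the normalised monomials: the source is `n` and the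
target is `p`. -/
def catMatrix (a : ℝ) (lam : ℂ) (hlam : ‖lam‖ < 1) (n p : ℤ × ℤ) : ℂ :=
  if p.2 = n.1 + n.2 then
    blaschkeCoeff lam hlam (n.1 + n.2) (p.1 - n.1) * (Real.exp (a * (growth p - growth n)) : ℂ)
  else 0

theorem catMatrix_ne_zero {a : ℝ} {lam : ℂ} {hlam : ‖lam‖ < 1} {n p : ℤ × ℤ}
    (h : catMatrix a lam hlam n p ≠ 0) :
    p.2 = n.1 + n.2 ∧ (0 ≤ n.1 + n.2 ∧ n.1 ≤ p.1 ∨ n.1 + n.2 ≤ 0 ∧ p.1 ≤ n.1) ∧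
      (n.1 + n.2 = 0 → p.1 = n.1) := by
  unfold catMatrix at h
  split_ifs at h with hp
  · have hb := left_ne_zero_of_mul h
    have h1 : 0 ≤ n.1 + n.2 → n.1 ≤ p.1 := fun hm => by
      by_contra hk
      exact hb (blaschkeCoeff_eq_zero hlam hm (by omega))
    have h2 : n.1 + n.2 ≤ 0 → p.1 ≤ n.1 := fun hm => by
      by_contra hk
      exact hb (blaschkeCoeff_eq_zero' hlam hm (by omega))
    exact ⟨hp, by omega, by omega⟩
  · exact absurd rfl h

theorem catMatrix_zero_left (a : ℝ) (lam : ℂ) (hlam : ‖lam‖ < 1) {n : ℤ × ℤ} (hn : n.1 = 0) :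
    catMatrix a lam hlam n n = eigenvalueList lam n.2 := by
  simp [catMatrix, hn, blaschkeCoeff_zero_right]

theorem exists_norm_catMatrix_le {a : ℝ} (ha : 0 < a) (lam : ℂ) (hlam : ‖lam‖ < 1) :
    ∃ c, 0 < c ∧ ∀ n p, ‖catMatrix a lam hlam n p‖ ≤
      (Real.exp (-(c * |(n.1 : ℝ)|)) * Real.exp (-(c * |(n.2 : ℝ)|))) *
        (Real.exp (-(c * |(p.1 : ℝ)|)) * Real.exp (-(c * |(p.2 : ℝ)|))) := by
  -- This radius costs only `exp (a |k| / 4)`, a quarter of what the weight gains.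
  obtain ⟨ρ, h0, h1, hρ⟩ := exists_norm_blaschkeCoeff_le hlam (r := Real.exp (-(a / 4)))
    (Real.exp_pos _) (Real.exp_lt_one_iff.mpr (by linarith))
  obtain ⟨e, he⟩ : ∃ e, Real.exp (-e) = ρ := ⟨-Real.log ρ, by rw [neg_neg, Real.exp_log h0]⟩
  have he0 : 0 < e := by
    rw [← he, Real.exp_lt_one_iff] at h1
    linarith
  -- The two bounds of `growth_drop` are averaged with weights `1 - t` and `t`. With `t ≤ 1 / 2` at
  -- least `a K / 2` of the first survives; with `4 a t ≤ e` the loss `2 a t m` uses at most half of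
  -- the decay `e m`.
  obtain ⟨t, ht0, ht1, ht2⟩ : ∃ t, 0 < t ∧ t ≤ 1 / 2 ∧ 4 * (a * t) ≤ e :=
    ⟨min (1 / 2) (e / (4 * a)), by positivity, min_le_left _ _, by
      have := mul_le_mul_of_nonneg_left (min_le_right (1 / 2) (e / (4 * a))) (by positivity : 0 ≤ 4 * a)
      rw [mul_div_cancel₀ _ (by positivity)] at this
      linarith⟩
  obtain ⟨d, hd0, hd1, hd2, hd3⟩ : ∃ d, 0 < d ∧ d ≤ a / 4 ∧ d ≤ e / 2 ∧ d ≤ a * t :=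
    ⟨min (a / 4) (min (e / 2) (a * t)), by positivity, min_le_left _ _,
      (min_le_right _ _).trans (min_le_left _ _), (min_le_right _ _).trans (min_le_right _ _)⟩
  -- The exponent is at most `-d (K + m + N)`, and `|n₁| + |n₂| + |p₁| + |p₂| ≤ K + 2 m + 3 N`,
  -- whence the factor `3`.
  refine ⟨d / 3, by positivity, fun n p => ?_⟩
  by_cases hz : catMatrix a lam hlam n p = 0
  · rw [hz, norm_zero]
    positivity
  obtain ⟨hp, hk, -⟩ := catMatrix_ne_zero hz
  obtain ⟨g1, g2⟩ := growth_drop hp hk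
  rw [catMatrix, if_pos hp, norm_mul, Complex.norm_real, Real.norm_of_nonneg (Real.exp_pos _).le]
  have hb := hρ (n.1 + n.2) (p.1 - n.1)
  rw [← he, ← Real.exp_neg, neg_neg, ← Real.exp_nat_mul, ← Real.exp_nat_mul, ← Real.exp_add,
    Nat.cast_natAbs, Nat.cast_natAbs] at hb
  refine (mul_le_mul_of_nonneg_right hb (Real.exp_pos _).le).trans ?_
  rw [← Real.exp_add, ← Real.exp_add, ← Real.exp_add, ← Real.exp_add, Real.exp_le_exp]
  have t1 : |(p.1 : ℝ)| ≤ |((p.1 - n.1 : ℤ) : ℝ)| + |(n.1 : ℝ)| := by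
    have := abs_add_le ((p.1 - n.1 : ℤ) : ℝ) (n.1 : ℝ)
    rwa [← Int.cast_add, sub_add_cancel] at this
  have t2 : |(n.2 : ℝ)| ≤ |((n.1 + n.2 : ℤ) : ℝ)| + |(n.1 : ℝ)| := by
    have := abs_sub ((n.1 + n.2 : ℤ) : ℝ) (n.1 : ℝ)
    rwa [← Int.cast_sub, add_sub_cancel_left] at this
  rw [hp]
  push_cast [Int.cast_abs] at *
  set K := |(p.1 : ℝ) - n.1|
  set m := |(n.1 : ℝ) + n.2|
  set N := |(n.1 : ℝ)|
  set G := growth n - growth p with hG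
  have hK : 0 ≤ K := abs_nonneg _
  have hm : 0 ≤ m := abs_nonneg _
  have hN : 0 ≤ N := abs_nonneg _
  have i1 : a * ((1 - t) * K + t * (N - 2 * m)) ≤ a * G :=
    mul_le_mul_of_nonneg_left (by nlinarith) ha.le
  have i2 : a * t * K ≤ a * (1 / 2) * K :=
    mul_le_mul_of_nonneg_right (mul_le_mul_of_nonneg_left ht1 ha.le) hK
  have i3 := mul_le_mul_of_nonneg_right ht2 hm
  have i4 := mul_le_mul_of_nonneg_right hd1 hK
  have i5 := mul_le_mul_of_nonneg_right hd2 hm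
  have i6 := mul_le_mul_of_nonneg_right hd3 hN
  have i7 := mul_le_mul_of_nonneg_left t1 hd0.le
  have i8 := mul_le_mul_of_nonneg_left t2 hd0.le
  have i9 := mul_nonneg hd0.le hK
  have i10 := mul_nonneg hd0.le hm
  have i11 := mul_nonneg hd0.le hN
  have i12 : a * (growth p - growth n) = -(a * G) := by rw [hG]; ring
  rw [i12]
  linarith

theorem summable_exp_neg_mul_abs {c : ℝ} (hc : 0 < c) :
    Summable fun k : ℤ => Real.exp (-(c * |(k : ℝ)|)) := by
  have h : Summable fun k : ℕ => Real.exp (-(c * (k : ℝ))) := by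
    convert! summable_geometric_of_lt_one (Real.exp_pos (-c)).le (Real.exp_lt_one_iff.mpr (by linarith))
      using 2 with k
    rw [← Real.exp_nat_mul]
    congr 1
    ring
  refine Summable.of_nat_of_neg ?_ ?_ <;> simpa using h

theorem summable_catMatrix {a : ℝ} (ha : 0 < a) (lam : ℂ) (hlam : ‖lam‖ < 1) :
    Summable fun q : (ℤ × ℤ) × (ℤ × ℤ) => ‖catMatrix a lam hlam q.1 q.2‖ := by
  obtain ⟨c, hc, h⟩ := exists_norm_catMatrix_le ha lam hlam
  have h1 := summable_exp_neg_mul_abs hc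
  have h2 := h1.mul_of_nonneg h1 (fun _ => (Real.exp_pos _).le) (fun _ => (Real.exp_pos _).le)
  have h3 := h2.mul_of_nonneg h2 (fun _ => mul_nonneg (Real.exp_pos _).le (Real.exp_pos _).le)
    (fun _ => mul_nonneg (Real.exp_pos _).le (Real.exp_pos _).le)
  exact Summable.of_nonneg_of_le (fun _ => norm_nonneg _) (fun q => h q.1 q.2) h3

/-- Everything follows from `p₂ = n₁ + n₂` and the fact that `p₁ - n₁` has the sign of `n₁ + n₂`, or
vanishes. On the line `n₁ = 0` one has `p₂ = n₂`, and any move of the first coordinate lands in `S`.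
-/
theorem isBlockTriangular_catMatrix {a : ℝ} (ha : 0 < a) (lam : ℂ) (hlam : ‖lam‖ < 1) :
    IsBlockTriangular (catMatrix a lam hlam)
      {n | 0 < n.1 ∧ 0 ≤ n.2 ∨ n.1 < 0 ∧ n.2 ≤ 0} {n | 0 < n.1 ∧ n.2 < 0 ∨ n.1 < 0 ∧ 0 < n.2}
      (fun n => n.2.natAbs) where
  summable := summable_catMatrix ha lam hlam
  of_mem_S n p hn h := by
    have := catMatrix_ne_zero h
    simp only [Set.mem_ofPred_eq] at *
    omega
  of_mem_R n p hp h := by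
    have := catMatrix_ne_zero h
    simp only [Set.mem_ofPred_eq] at *
    omega
  of_notMem n p h1 h2 h3 h := by
    have := catMatrix_ne_zero h
    simp only [Set.mem_ofPred_eq] at *
    exact Prod.ext (by omega) (by omega)

/-! ### The basis of normalised monomials -/

theorem sqrt_weight_sq (a : ℝ) (n : ℤ × ℤ) : Real.exp (a * growth n) ^ 2 = weight a n := by
  rw [weight_eq, ← Real.exp_nat_mul]
  congr 1
  push_cast
  ring

theorem LaurentPoly.eq_sum_monomial {a : ℝ} (f : LaurentPoly a) :
    f = ∑ n ∈ f.coeff.support, f.coeff n • LaurentPoly.monomial a n := by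
  have h := (Finsupp.sum_single f.coeff).symm
  have h1 : ∀ n, f.coeff n • LaurentPoly.monomial a n =
      (Finsupp.single n (f.coeff n) : (ℤ × ℤ) →₀ ℂ) := fun n => by
    change f.coeff n • (Finsupp.single n 1 : (ℤ × ℤ) →₀ ℂ) = _
    rw [Finsupp.smul_single, smul_eq_mul, mul_one]
  simp only [h1]
  exact h

theorem inner_monomial (a : ℝ) (n p : ℤ × ℤ) :
    inner ℂ (LaurentPoly.monomial a n : HSpace a) (LaurentPoly.monomial a p : HSpace a) =
      if n = p then (weight a p : ℂ) else 0 := by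
  rw [UniformSpace.Completion.inner_coe]
  change LaurentPoly.innerA _ _ = _
  rw [LaurentPoly.innerA_eq _ _ {p} (by
    change (Finsupp.single p (1 : ℂ)).support ⊆ {p}
    exact Finsupp.support_single_subset), Finset.sum_singleton]
  change conj ((Finsupp.single n (1 : ℂ)) p) * (Finsupp.single p (1 : ℂ)) p * _ = _
  rw [Finsupp.single_apply, Finsupp.single_eq_same]
  split_ifs <;> simp

/-- The monomials, normalised in `H_a`. -/
def normalizedMonomial (a : ℝ) (n : ℤ × ℤ) : HSpace a :=
  (Real.exp (-(a * growth n)) : ℂ) • (LaurentPoly.monomial a n : HSpace a)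

theorem exp_smul_normalizedMonomial (a : ℝ) (n : ℤ × ℤ) :
    (Real.exp (a * growth n) : ℂ) • normalizedMonomial a n =
      (LaurentPoly.monomial a n : HSpace a) := by
  rw [normalizedMonomial, smul_smul, ← Complex.ofReal_mul, ← Real.exp_add, add_neg_cancel,
    Real.exp_zero, Complex.ofReal_one, one_smul]

theorem orthonormal_normalizedMonomial (a : ℝ) : Orthonormal ℂ (normalizedMonomial a) := by
  classical
  rw [orthonormal_iff_ite]
  intro n p
  rw [normalizedMonomial, normalizedMonomial, inner_smul_left, inner_smul_right, inner_monomial,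
    Complex.conj_ofReal]
  split_ifs with h
  · rw [h, ← sqrt_weight_sq, ← Complex.ofReal_mul, ← Complex.ofReal_mul, sq, ← Real.exp_add,
      ← Real.exp_add, ← Real.exp_add]
    simp
  · simp

theorem coe_laurentPoly_eq_sum {a : ℝ} (f : LaurentPoly a) :
    (f : HSpace a) =
      ∑ n ∈ f.coeff.support, f.coeff n • (LaurentPoly.monomial a n : HSpace a) := by
  have h := congrArg (UniformSpace.Completion.toComplL (𝕜 := ℂ) (E := LaurentPoly a))
    f.eq_sum_monomial
  rw [map_sum] at h
  simp only [map_smul] at h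
  exact h

theorem dense_span_normalizedMonomial (a : ℝ) :
    ⊤ ≤ (Submodule.span ℂ (Set.range (normalizedMonomial a))).topologicalClosure := by
  rw [top_le_iff, ← Submodule.dense_iff_topologicalClosure_eq_top]
  refine (UniformSpace.Completion.denseRange_coe (α := LaurentPoly a)).mono ?_
  rintro _ ⟨f, rfl⟩
  rw [coe_laurentPoly_eq_sum]
  refine Submodule.sum_mem _ fun n _ => Submodule.smul_mem _ _ ?_
  rw [← exp_smul_normalizedMonomial]
  exact Submodule.smul_mem _ _ (Submodule.subset_span ⟨n, rfl⟩)

/-- The Hilbert basis of normalised monomials. -/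
def monomialBasis (a : ℝ) : HilbertBasis (ℤ × ℤ) ℂ (HSpace a) :=
  HilbertBasis.mk (orthonormal_normalizedMonomial a) (dense_span_normalizedMonomial a)

theorem monomialBasis_apply (a : ℝ) (n : ℤ × ℤ) : monomialBasis a n = normalizedMonomial a n := by
  rw [monomialBasis, HilbertBasis.coe_mk]

/-! ### Fourier coefficients on the torus -/

theorem circleCoeff_zpow (m k : ℤ) :
    circleCoeff (fun z => (z : ℂ) ^ m) k = if m = k then 1 else 0 := by
  have h := circleCoeff_eq_circleIntegral (fun z => z ^ m) k
  have h1 : (∮ z in C(0, 1), (z : ℂ) ^ (-k - 1) * z ^ m) = ∮ z in C(0, 1), (z - 0) ^ (m - k - 1) := by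
    refine circleIntegral.integral_congr zero_le_one fun z hz => ?_
    have hz0 : z ≠ 0 := by
      rintro rfl
      simp at hz
    change z ^ (-k - 1) * z ^ m = (z - 0) ^ (m - k - 1)
    rw [← zpow_add₀ hz0, sub_zero]
    congr 1
    ring
  rw [h1] at h
  refine h.trans ?_
  split_ifs with hmk
  · rw [hmk, sub_self, zero_sub]
    simp only [zpow_neg_one]
    rw [circleIntegral.integral_sub_center_inv 0 one_ne_zero,
      inv_mul_cancel₀ Complex.two_pi_I_ne_zero]
  · rw [circleIntegral.integral_sub_zpow_of_ne (by omega), mul_zero]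

theorem circleCoeff_zpow_mul (g : Circle → ℂ) (n k : ℤ) :
    circleCoeff (fun z => (z : ℂ) ^ n * g z) k = circleCoeff g (k - n) := by
  unfold circleCoeff
  congr 1
  refine intervalIntegral.integral_congr fun θ _ => ?_
  change (Circle.exp θ : ℂ) ^ n * g (Circle.exp θ) * _ = g (Circle.exp θ) * _
  rw [Circle.coe_exp, ← Complex.exp_int_mul, mul_comm (Complex.exp _), mul_assoc, ← Complex.exp_add]
  congr 2
  push_cast
  ring

theorem torusFourierCoeff_mul (g h : Circle → ℂ) (p : ℤ × ℤ) :
    torusFourierCoeff (fun z => g z.1 * h z.2) p = circleCoeff g p.1 * circleCoeff h p.2 := by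
  unfold torusFourierCoeff circleCoeff
  have h1 : ∀ θ₁ θ₂ : ℝ, g (Circle.exp θ₁) * h (Circle.exp θ₂) *
      Complex.exp (-Complex.I * ((p.1 : ℂ) * (θ₁ : ℂ) + (p.2 : ℂ) * (θ₂ : ℂ))) =
      (g (Circle.exp θ₁) * Complex.exp (-Complex.I * ((p.1 : ℂ) * (θ₁ : ℂ)))) *
        (h (Circle.exp θ₂) * Complex.exp (-Complex.I * ((p.2 : ℂ) * (θ₂ : ℂ)))) := by
    intro θ₁ θ₂
    rw [mul_add, Complex.exp_add]
    ring
  simp only [h1, intervalIntegral.integral_const_mul, intervalIntegral.integral_mul_const]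
  ring

theorem torusFourierCoeff_sum {ι : Type*} (s : Finset ι) (c : ι → ℂ) (g : ι → Torus → ℂ)
    (hg : ∀ i ∈ s, Continuous (g i)) (p : ℤ × ℤ) :
    torusFourierCoeff (fun z => ∑ i ∈ s, c i * g i z) p =
      ∑ i ∈ s, c i * torusFourierCoeff (g i) p := by
  unfold torusFourierCoeff
  have hc : ∀ i ∈ s, Continuous fun q : ℝ × ℝ => g i (Circle.exp q.1, Circle.exp q.2) *
      Complex.exp (-Complex.I * ((p.1 : ℂ) * (q.1 : ℂ) + (p.2 : ℂ) * (q.2 : ℂ))) := fun i hi => by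
    have h1 := (hg i hi).comp (f := fun q : ℝ × ℝ => (Circle.exp q.1, Circle.exp q.2))
      (by fun_prop)
    exact h1.mul (by fun_prop)
  simp only [Finset.sum_mul, mul_assoc]
  have h1 : ∀ θ₁ : ℝ, ∫ θ₂ in (0 : ℝ)..2 * Real.pi, ∑ i ∈ s,
      c i * (g i (Circle.exp θ₁, Circle.exp θ₂) *
        Complex.exp (-Complex.I * ((p.1 : ℂ) * (θ₁ : ℂ) + (p.2 : ℂ) * (θ₂ : ℂ)))) =
      ∑ i ∈ s, c i * ∫ θ₂ in (0 : ℝ)..2 * Real.pi, g i (Circle.exp θ₁, Circle.exp θ₂) *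
        Complex.exp (-Complex.I * ((p.1 : ℂ) * (θ₁ : ℂ) + (p.2 : ℂ) * (θ₂ : ℂ))) := by
    intro θ₁
    rw [intervalIntegral.integral_finsetSum]
    · simp only [intervalIntegral.integral_const_mul]
    · intro i hi
      refine Continuous.intervalIntegrable ?_ _ _
      exact continuous_const.mul ((hc i hi).comp (f := fun θ₂ : ℝ => (θ₁, θ₂)) (by fun_prop))
  simp only [h1]
  rw [intervalIntegral.integral_finsetSum, Finset.mul_sum]
  · simp only [intervalIntegral.integral_const_mul]
    exact Finset.sum_congr rfl fun i _ => by ring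
  · intro i hi
    refine Continuous.intervalIntegrable (continuous_const.mul ?_) _ _
    exact intervalIntegral.continuous_parametric_intervalIntegral_of_continuous' (hc i hi) _ _

/-! ### The composition operator -/

section CompositionOperator

variable {lam : ℂ} (hlam : ‖lam‖ < 1)

theorem continuous_blaschke : Continuous fun z : Circle => (blaschke lam hlam z : ℂ) := by
  change Continuous fun z : Circle => ((z : ℂ) - lam) / (1 - conj lam * (z : ℂ))
  exact Continuous.div (by fun_prop) (by fun_prop) (one_sub_conj_mul_ne_zero hlam)

/-- The composition of a monomial with the cat map. -/
def monomialComp (lam : ℂ) (hlam : ‖lam‖ < 1) (n : ℤ × ℤ) (z : Torus) : ℂ :=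
  ((z.1 : ℂ) ^ n.1 * (blaschke lam hlam z.1 : ℂ) ^ (n.1 + n.2)) * (z.2 : ℂ) ^ (n.1 + n.2)

theorem continuous_monomialComp (n : ℤ × ℤ) : Continuous (monomialComp lam hlam n) := by
  have h1 := (continuous_blaschke hlam).comp (continuous_fst (X := Circle) (Y := Circle))
  refine ((Continuous.zpow₀ (by fun_prop) _ fun z => Or.inl (Circle.coe_ne_zero _)).mul
    (h1.zpow₀ _ fun z => Or.inl (Circle.coe_ne_zero _))).mul
    (Continuous.zpow₀ (by fun_prop) _ fun z => Or.inl (Circle.coe_ne_zero _))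

theorem eval_catMap {a : ℝ} (f : LaurentPoly a) (z : Torus) :
    f.eval (catMap lam hlam z) = ∑ n ∈ f.coeff.support, f.coeff n * monomialComp lam hlam n z := by
  refine Finset.sum_congr rfl fun n _ => ?_
  have hb : (blaschke lam hlam z.1 : ℂ) ≠ 0 := Circle.coe_ne_zero _
  have hz : (z.2 : ℂ) ≠ 0 := Circle.coe_ne_zero _
  simp only [catMap, monomialComp, Circle.coe_mul, mul_zpow, zpow_add₀ hb, zpow_add₀ hz]
  ring

theorem torusFourierCoeff_monomialComp (n p : ℤ × ℤ) :
    torusFourierCoeff (monomialComp lam hlam n) p =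
      if p.2 = n.1 + n.2 then blaschkeCoeff lam hlam (n.1 + n.2) (p.1 - n.1) else 0 := by
  refine (torusFourierCoeff_mul
    (fun z => (z : ℂ) ^ n.1 * (blaschke lam hlam z : ℂ) ^ (n.1 + n.2))
    (fun z => (z : ℂ) ^ (n.1 + n.2)) p).trans ?_
  rw [circleCoeff_zpow_mul, circleCoeff_zpow, blaschkeCoeff]
  simp only [eq_comm (a := p.2)]
  split_ifs <;> simp

/-- The composition operator of the cat map. -/
def compositionOp (a : ℝ) (lam : ℂ) (hlam : ‖lam‖ < 1) : HSpace a →L[ℂ] HSpace a :=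
  matrixOp (monomialBasis a) (catMatrix a lam hlam)

theorem hasSum_compositionOp_monomial {a : ℝ} (ha : 0 < a) (n : ℤ × ℤ) :
    HasSum (fun p => torusFourierCoeff (monomialComp lam hlam n) p •
      (LaurentPoly.monomial a p : HSpace a))
      (compositionOp a lam hlam (LaurentPoly.monomial a n : HSpace a)) := by
  have h := (hasSum_matrixOp_basis (monomialBasis a) (summable_catMatrix ha lam hlam) n).const_smul
    (Real.exp (a * growth n) : ℂ)
  rw [← map_smul, monomialBasis_apply, exp_smul_normalizedMonomial] at h
  convert! h using 2 with p
  rw [monomialBasis_apply, torusFourierCoeff_monomialComp, catMatrix, smul_smul]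
  split_ifs with hp
  · rw [← exp_smul_normalizedMonomial a p, smul_smul]
    congr 1
    -- The normalising factors of source and target cancel the weight ratio in the matrix entry.
    rw [mul_left_comm, ← Complex.ofReal_mul, ← Real.exp_add]
    congr 3
    ring
  · simp

theorem isCompositionOperator_compositionOp {a : ℝ} (ha : 0 < a) :
    IsCompositionOperator (compositionOp a lam hlam) (catMap lam hlam) := by
  intro f
  simp only [eval_catMap]
  refine ⟨continuous_finsetSum _ fun n _ =>
    continuous_const.mul (continuous_monomialComp hlam n), ?_⟩
  have h := hasSum_sum fun n (_ : n ∈ f.coeff.support) =>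
    (hasSum_compositionOp_monomial hlam ha n).const_smul (f.coeff n)
  rw [coe_laurentPoly_eq_sum, map_sum]
  simp only [map_smul]
  convert! h using 2 with p
  rw [torusFourierCoeff_sum _ _ _ fun n _ => continuous_monomialComp hlam n, Finset.sum_smul]
  simp only [smul_smul]

end CompositionOperator

/-- Both operators send a Laurent polynomial to the sum of the same Fourier series, and Laurent
polynomials are dense. -/
theorem IsCompositionOperator.unique {a : ℝ} {T : Torus → Torus} {C C' : HSpace a →L[ℂ] HSpace a}
    (h : IsCompositionOperator C T) (h' : IsCompositionOperator C' T) : C' = C := by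
  refine ContinuousLinearMap.coeFn_injective
    (UniformSpace.Completion.denseRange_coe.equalizer C'.continuous C.continuous ?_)
  funext f
  exact (h' f).2.unique (h f).2

/-- The complement of `S` and `R` is the line `n₁ = 0`, so multiplicities are counted in
`eigenvalueList`. -/
theorem diagIndices_catMatrix (a : ℝ) (lam : ℂ) (hlam : ‖lam‖ < 1) (μ : ℂ) :
    IsBlockTriangular.diagIndices (catMatrix a lam hlam)
      {n | 0 < n.1 ∧ 0 ≤ n.2 ∨ n.1 < 0 ∧ n.2 ≤ 0} {n | 0 < n.1 ∧ n.2 < 0 ∨ n.1 < 0 ∧ 0 < n.2} μ =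
      (fun k : ℤ => ((0, k) : ℤ × ℤ)) '' {k | eigenvalueList lam k = μ} := by
  ext n
  simp only [IsBlockTriangular.diagIndices, Set.mem_ofPred_eq, Set.mem_image]
  constructor
  · rintro ⟨h1, h2, h3⟩
    have h0 : n.1 = 0 := by omega
    rw [catMatrix_zero_left a lam hlam h0] at h3
    exact ⟨n.2, h3, Prod.ext h0.symm rfl⟩
  · rintro ⟨k, hk, rfl⟩
    exact ⟨by simp, by simp, by rw [catMatrix_zero_left a lam hlam rfl, hk]⟩

theorem exists_eigenvalueList_eq_iff (lam μ : ℂ) :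
    (∃ k, eigenvalueList lam k = μ) ↔
      (∃ n : ℕ, 1 ≤ n ∧ μ = (-lam) ^ n) ∨ (∃ n : ℕ, 1 ≤ n ∧ μ = (-conj lam) ^ n) ∨ μ = 1 := by
  constructor
  · rintro ⟨k, rfl⟩
    unfold eigenvalueList
    rcases lt_trichotomy k 0 with hk | rfl | hk
    · exact Or.inr (Or.inl ⟨k.natAbs, by omega, by rw [if_neg (by omega)]⟩)
    · simp
    · exact Or.inl ⟨k.natAbs, by omega, by rw [if_pos hk.le]⟩
  · rintro (⟨n, -, rfl⟩ | ⟨n, hn, rfl⟩ | rfl)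
    · exact ⟨n, by simp [eigenvalueList]⟩
    · exact ⟨-n, by rw [eigenvalueList, if_neg (by omega)]; simp⟩
    · exact ⟨0, by simp [eigenvalueList]⟩

end BlaschkeCat

end

theorem theorem1 (a : ℝ) (ha : 0 < a) (lam : ℂ) (hlam : ‖lam‖ < 1) :
    ∃ C : BlaschkeCat.HSpace a →L[ℂ] BlaschkeCat.HSpace a,
      BlaschkeCat.IsCompositionOperator C (BlaschkeCat.catMap lam hlam) ∧
      (∀ C' : BlaschkeCat.HSpace a →L[ℂ] BlaschkeCat.HSpace a,
        BlaschkeCat.IsCompositionOperator C' (BlaschkeCat.catMap lam hlam) → C' = C) ∧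
      IsCompactOperator C ∧
      BlaschkeCat.IsHilbertSchmidt C ∧
      spectrum ℂ C =
        {μ | ∃ n : ℕ, 1 ≤ n ∧ μ = (-lam) ^ n} ∪
          {μ | ∃ n : ℕ, 1 ≤ n ∧ μ = (-(starRingEnd ℂ) lam) ^ n} ∪ {1, 0} ∧
      ∀ μ ∈ spectrum ℂ C, μ ≠ 0 →
        Module.End.HasEigenvalue (C : Module.End ℂ (BlaschkeCat.HSpace a)) μ ∧
        FiniteDimensional ℂ (BlaschkeCat.genEigenspace C μ) ∧
        {k : ℤ | BlaschkeCat.eigenvalueList lam k = μ}.Finite ∧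
        Module.finrank ℂ (BlaschkeCat.genEigenspace C μ) =
          {k : ℤ | BlaschkeCat.eigenvalueList lam k = μ}.ncard := by
  have hM := BlaschkeCat.isBlockTriangular_catMatrix ha lam hlam
  have hC := BlaschkeCat.isCompositionOperator_compositionOp hlam ha
  have hinj : Function.Injective fun k : ℤ => ((0, k) : ℤ × ℤ) :=
    fun i j h => (Prod.ext_iff.mp h).2
  refine ⟨BlaschkeCat.compositionOp a lam hlam, hC, fun C' h => hC.unique h,
    BlaschkeCat.isCompactOperator_matrixOp _ hM.summable,
    BlaschkeCat.isHilbertSchmidt_matrixOp _ hM.summable, ?_, fun μ hμ h0 => ?_⟩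
  · ext μ
    rcases eq_or_ne μ 0 with rfl | h0
    · simp only [Set.mem_union, Set.mem_insert_iff, Set.mem_singleton_iff, or_true, iff_true]
      exact BlaschkeCat.zero_mem_spectrum_matrixOp _ hM.summable
    · refine (hM.mem_spectrum_iff _ h0).trans ?_
      rw [BlaschkeCat.diagIndices_catMatrix, Set.image_nonempty]
      refine (BlaschkeCat.exists_eigenvalueList_eq_iff lam μ).trans ?_
      simp only [Set.mem_union, Set.mem_insert_iff, Set.mem_singleton_iff, Set.mem_ofPred_eq, h0,
        or_false, or_assoc]
  · have hne := (hM.mem_spectrum_iff (BlaschkeCat.monomialBasis a) h0).mp hμ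
    obtain ⟨h1, h2⟩ := hM.finrank_genEigenspace (BlaschkeCat.monomialBasis a) h0
    have hfin := hM.finite_diagIndices h0
    rw [BlaschkeCat.diagIndices_catMatrix] at h2 hfin
    rw [Set.ncard_image_of_injective _ hinj] at h2
    exact ⟨(hM.hasEigenvalue_iff _ h0).mpr hne, h1, hfin.of_finite_image hinj.injOn, h2⟩
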